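/- Let $r\ge 2$ be even, let $m\ge 3$ be odd, $n=2^m-1$, and let $t\neq 1$ be an odd integer with $m\equiv t\pmod r$. Let $S\subset\mathbb Z_r$ with $|S|=r/2$, put $S'=\mathbb Z_r\setminus S$, and assume that $t-i\in S'$ for every $i\in S$. Let $\alpha$ be a generator of $\mathbb F_{2^m}^{*}$ and let $w_2(j)$ be the number of ones in the binary expansion of $j$. For $A\in\{S,S'\}$ put $T_A=\{1\le j\le n-1 : w_2(j) \bmod r\in A\}$ and let $\mathcal C_A$ be the binary cyclic code of length $n$ with generator polynomial $g_A(x)=\prod_{j\in T_A}(x-\alpha^j)$, which has coefficients in $\mathbb F_2$. Suppose that $S$ contains (modulo $r$) the elements $\frac{t-1}2,\frac{t+r+1}2,1$, or the elements $\frac{t+1}2,\frac{t+r-1}2,t-1$. The defining set of a cyclic code of length $n$ with generator polynomial $g$ is $\{i\in\mathbb Z_n : g(\alpha^i)=0\}$. Two binary cyclic codes of length $n$ form a pair of odd-like (respectively even-like) duadic codes if their defining sets are $S_1$ and $S_2$ (respectively $\{0\}\cup S_1$ and $\{0\}\cup S_2$), where $S_1,S_2$ are unions of $2$-cyclotomic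 cosets modulo $n$ that partition $\mathbb Z_n\setminus\{0\}$ and there is a unit $\mu\in\mathbb Z_n$ with $\mu S_1=S_2$ and $\mu S_2=S_1$. Then: (1) $\mathcal C_S$ and $\mathcal C_{S'}$ form a pair of odd-like duadic codes; both have parameters $[2^m-1,2^{m-1},d]$ with the same $d$, where $d\ge 2^{(m-1)/2}+1$ if $m\equiv t\pmod{2r}$, and $d\ge 2^{(m-1)/2}+3$ if $m\equiv t+r\pmod{2r}$. (2) The dual codes $\mathcal C_S^{\perp}$ and $\mathcal C_{S'}^{\perp}$ form a pair of even-like duadic codes; both have parameters $[2^m-1,2^{m-1}-1,d^{\perp}]$ with the same $d^{\perp}$, where $d^{\perp}\ge 2^{(m-1)/2}+2$ if $m\equiv t\pmod{2r}$, and $d^{\perp}\ge 2^{(m-1)/2}+4$ if $m\equiv t+r\pmod{2r}$. (3) The extended codes $\overline{\mathcal C_S}$ and $\overline{\mathcal C_{S'}}$ (obtained by appending an overall parity-check coordinate to every codeword) both have parameters $[2^m,2^{m-1},\overline d]$ with the same $\overline d$, and $\overline d\ge 2^{(m-1)/2}+4$ whenever $m\ge 5$. Moreover, both are self-dual and doubly-even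 (all weights are divisible by $4$). -/

import Mathlib

open Polynomial

/-- The number of ones in the binary expansion of `j`. -/
def binaryWeight (j : ℕ) : ℕ := (Nat.digits 2 j).sum

open Classical in
/-- The set of all `1 ≤ j ≤ 2 ^ m - 2` whose binary weight, reduced modulo `r`, lies in `S`. -/
noncomputable def weightSet (r m : ℕ) (S : Set (ZMod r)) : Finset ℕ :=
  (Finset.Icc 1 (2 ^ m - 2)).filter (fun j => ((binaryWeight j : ℕ) : ZMod r) ∈ S)

/-- The product of `X - α ^ j` over `j ∈ weightSet r m S`, as a polynomial over the field
containing `α`. -/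
noncomputable def weightPoly {F : Type*} [Field F] (α : F) (r m : ℕ) (S : Set (ZMod r)) : F[X] :=
  ∏ j ∈ weightSet r m S, (X - C (α ^ j))

/-- Binary linear codes of length `n`. -/
abbrev BinaryCode (n : ℕ) : Type := Submodule (ZMod 2) (Fin n → ZMod 2)

/-- A word `(c₀, …, c_{n-1})` regarded as the class of `c₀ + c₁ x + ⋯ + c_{n-1} x ^ (n-1)` in
`𝔽₂[x] / (x ^ n - 1)`. -/
noncomputable def wordClass (n : ℕ) :
    (Fin n → ZMod 2) →ₗ[ZMod 2] (ZMod 2)[X] ⧸ Ideal.span {(X ^ n - 1 : (ZMod 2)[X])} :=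
  (Ideal.Quotient.mkₐ (ZMod 2) (Ideal.span {(X ^ n - 1 : (ZMod 2)[X])})).toLinearMap ∘ₗ
    ∑ i : Fin n, (Polynomial.monomial (i : ℕ)) ∘ₗ LinearMap.proj i

/-- The binary cyclic code of length `n` generated by `g`: the words whose class lies in the
ideal of `𝔽₂[x] / (x ^ n - 1)` generated by `g`. -/
noncomputable def cyclicCode (n : ℕ) (g : (ZMod 2)[X]) : BinaryCode n :=
  ((Ideal.span {Ideal.Quotient.mk (Ideal.span {(X ^ n - 1 : (ZMod 2)[X])}) g}).restrictScalars
    (ZMod 2)).comap (wordClass n)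

/-- `C` is a cyclic code of length `n` with defining set `T` with respect to `α` (a primitive
`n`-th root of unity): its generator polynomial `g`, a monic divisor of `x ^ n - 1`, satisfies
`g (α ^ i) = 0` exactly for `i ∈ T`. -/
def HasDefiningSet {F : Type*} [Field F] [Algebra (ZMod 2) F] {n : ℕ} (α : F)
    (C : BinaryCode n) (T : Set (ZMod n)) : Prop :=
  ∃ g : (ZMod 2)[X], g.Monic ∧ g ∣ X ^ n - 1 ∧ C = cyclicCode n g ∧
    T = {i : ZMod n | aeval (α ^ i.val) g = 0}

/-- `T` is a union of 2-cyclotomic cosets modulo `n`. -/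
def IsUnionOfCosets {n : ℕ} (T : Set (ZMod n)) : Prop :=
  ∀ s ∈ T, ∀ k : ℕ, s * 2 ^ k ∈ T

/-- `(S₁, S₂, μ)` is a splitting of `ℤ / n` into unions of 2-cyclotomic cosets. -/
def IsSplitting {n : ℕ} (S₁ S₂ : Set (ZMod n)) (μ : (ZMod n)ˣ) : Prop :=
  IsUnionOfCosets S₁ ∧ IsUnionOfCosets S₂ ∧
    S₁ ∪ S₂ = Set.univ \ {0} ∧ S₁ ∩ S₂ = ∅ ∧
    (fun s => s * (μ : ZMod n)) '' S₁ = S₂ ∧ (fun s => s * (μ : ZMod n)) '' S₂ = S₁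

/-- `C₁` and `C₂` form a pair of odd-like duadic codes. -/
def IsOddLikeDuadicPair {F : Type*} [Field F] [Algebra (ZMod 2) F] {n : ℕ} (α : F)
    (C₁ C₂ : BinaryCode n) : Prop :=
  ∃ (S₁ S₂ : Set (ZMod n)) (μ : (ZMod n)ˣ), IsSplitting S₁ S₂ μ ∧
    HasDefiningSet α C₁ S₁ ∧ HasDefiningSet α C₂ S₂

/-- `C₁` and `C₂` form a pair of even-like duadic codes. -/
def IsEvenLikeDuadicPair {F : Type*} [Field F] [Algebra (ZMod 2) F] {n : ℕ} (α : F)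
    (C₁ C₂ : BinaryCode n) : Prop :=
  ∃ (S₁ S₂ : Set (ZMod n)) (μ : (ZMod n)ˣ), IsSplitting S₁ S₂ μ ∧
    HasDefiningSet α C₁ ({0} ∪ S₁) ∧ HasDefiningSet α C₂ ({0} ∪ S₂)

/-- The minimum Hamming distance between distinct codewords (used here only for nonzero codes). -/
noncomputable def minDistance {n : ℕ} (C : BinaryCode n) : ℕ :=
  sInf {d : ℕ | ∃ x ∈ C, ∃ y ∈ C, x ≠ y ∧ hammingDist x y = d}

/-- `C` is an `[N, k, d]` code. -/
def HasParameters {n : ℕ} (C : BinaryCode n) (N k d : ℕ) : Prop :=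
  n = N ∧ Module.finrank (ZMod 2) C = k ∧ minDistance C = d

/-- The dual code, with respect to the standard dot product. -/
def dualCode {n : ℕ} (C : BinaryCode n) : BinaryCode n where
  carrier := {u | ∀ v ∈ C, u ⬝ᵥ v = 0}
  add_mem' := fun {a b} ha hb v hv => by rw [add_dotProduct, ha v hv, hb v hv, add_zero]
  zero_mem' := fun v _ => zero_dotProduct v
  smul_mem' := fun c x hx v hv => by rw [smul_dotProduct, hx v hv, smul_zero]

/-- The extended code: a parity coordinate is appended to every codeword, so that the sum of
all `n + 1` coordinates is zero. -/
def extendedCode {n : ℕ} (C : BinaryCode n) : BinaryCode (n + 1) where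
  carrier := {c | (fun i : Fin n => c i.castSucc) ∈ C ∧ ∑ i, c i = 0}
  add_mem' := fun {a b} ha hb =>
    ⟨C.add_mem ha.1 hb.1, by simp only [Pi.add_apply, Finset.sum_add_distrib, ha.2, hb.2, add_zero]⟩
  zero_mem' := ⟨C.zero_mem, by simp⟩
  smul_mem' := fun k x hx =>
    ⟨C.smul_mem k hx.1, by simp only [Pi.smul_apply, ← Finset.smul_sum, hx.2, smul_zero]⟩

/-- `C` equals its dual. -/
def IsSelfDual {n : ℕ} (C : BinaryCode n) : Prop := C = dualCode C

/-- All codewords of `C` have Hamming weight divisible by four. -/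
def IsDoublyEven {n : ℕ} (C : BinaryCode n) : Prop := ∀ c ∈ C, 4 ∣ hammingNorm c

/-! ### Binary weight under bit operations -/

section BinaryWeight

/-! Put n = 2^m - 1 and h = (m - 1) / 2. Exponents modulo n are m-bit words: doubling rotates the
bits and negation complements them. So T_S is closed under doubling, which puts its polynomial over
𝔽₂, and w(n - j) = m - w(j) ≡ t - w(j) mod r. Since |S| = r / 2, the map i ↦ t - i exchanges S and
S', hence -1 exchanges T_S and T_S'. This is the splitting. It gives the dimensions, and reversing
coordinates carries one code to the other, so their minimum distances agree.

Parseval's identity (`algebraMap_dotProduct`) pairs frequency j with -j. For j ≠ 0 one of the two is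
a common zero, so the product of two codewords is the product of their parities
(`dotProduct_of_wordEval_eq_zero`). Hence the dual is the even-weight subcode and the extension is
self-dual. An even-weight codeword is orthogonal to all its shifts, and counting differences in its
support shows that 4 divides its weight (`four_dvd_card_of_even_differences`); odd weights follow by
complementing, as n ≡ 3 mod 4.

For the distance, the numbers a(2^k - 1) with 1 ≤ a ≤ 2^h all have binary weight k when k is h or h
+ 1, and the residue hypotheses put one such k into S. As 2^k - 1 is prime to n, the BCH bound gives
weights above 2^h. The sharper bounds come from divisibility, not from a longer run of zeros: if m ≥
5 then 4 ∣ 2^h, so an extended weight is at least 2^h + 4. The case m = 3 of m ≡ t + r mod 2r cannot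
occur (`not_three_modEq_add`). -/

theorem binaryWeight_two_mul (j : ℕ) : binaryWeight (2 * j) = binaryWeight j := by
  rcases Nat.eq_zero_or_pos j with rfl | hj
  · simp
  · rw [binaryWeight, Nat.digits_def' (by norm_num) (by omega)]
    simp [binaryWeight]

theorem binaryWeight_two_mul_add_one (j : ℕ) :
    binaryWeight (2 * j + 1) = binaryWeight j + 1 := by
  rw [binaryWeight, Nat.digits_def' (by norm_num) (by omega)]
  have h1 : (2 * j + 1) % 2 = 1 := by omega
  have h2 : (2 * j + 1) / 2 = j := by omega
  rw [h1, h2, List.sum_cons, binaryWeight, add_comm]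

theorem binaryWeight_zero : binaryWeight 0 = 0 := by simp [binaryWeight]

theorem binaryWeight_one : binaryWeight 1 = 1 := by
  simpa [binaryWeight_zero] using binaryWeight_two_mul_add_one 0

/-- Subtracting from 2^m - 1 flips each of the m bits. -/
theorem binaryWeight_complement (m : ℕ) :
    ∀ j < 2 ^ m, binaryWeight (2 ^ m - 1 - j) + binaryWeight j = m := by
  induction m with
  | zero => intro j hj; simp_all [binaryWeight]
  | succ m ih =>
    intro j hj
    have := ih (j / 2) (by rw [pow_succ] at hj; omega)
    rcases Nat.even_or_odd' j with ⟨k, rfl | rfl⟩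
    · have hk : 2 * k / 2 = k := by omega
      rw [hk] at this
      have : 2 ^ (m + 1) - 1 - 2 * k = 2 * (2 ^ m - 1 - k) + 1 := by
        rw [pow_succ] at hj ⊢; omega
      rw [this, binaryWeight_two_mul, binaryWeight_two_mul_add_one]; omega
    · have hk : (2 * k + 1) / 2 = k := by omega
      rw [hk] at this
      have : 2 ^ (m + 1) - 1 - (2 * k + 1) = 2 * (2 ^ m - 1 - k) := by
        rw [pow_succ] at hj ⊢; omega
      rw [this, binaryWeight_two_mul, binaryWeight_two_mul_add_one]; omega

theorem binaryWeight_add_two_pow_mul (k b : ℕ) :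
    ∀ a < 2 ^ k, binaryWeight (a + 2 ^ k * b) = binaryWeight a + binaryWeight b := by
  induction k with
  | zero => intro a ha; simp_all [binaryWeight]
  | succ k ih =>
    intro a ha
    have ha2 : a / 2 < 2 ^ k := by rw [pow_succ] at ha; omega
    have := ih _ ha2
    rcases Nat.even_or_odd' a with ⟨c, rfl | rfl⟩
    · have hk : 2 * c / 2 = c := by omega
      rw [hk] at this
      rw [show 2 * c + 2 ^ (k + 1) * b = 2 * (c + 2 ^ k * b) by ring, binaryWeight_two_mul,
        binaryWeight_two_mul, this]
    · have hk : (2 * c + 1) / 2 = c := by omega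
      rw [hk] at this
      rw [show 2 * c + 1 + 2 ^ (k + 1) * b = 2 * (c + 2 ^ k * b) + 1 by ring,
        binaryWeight_two_mul_add_one, binaryWeight_two_mul_add_one, this]
      ring

/-- With b = a - 1, the product has b as its high part and the h-bit complement of b as its low
part. -/
theorem binaryWeight_mul_two_pow_sub_one {h a : ℕ} (ha : 1 ≤ a) (hah : a ≤ 2 ^ h) :
    binaryWeight (a * (2 ^ h - 1)) = h := by
  obtain ⟨b, rfl⟩ := Nat.exists_eq_add_of_le' ha
  have h1 : (b + 1) * (2 ^ h - 1) = (2 ^ h - 1 - b) + 2 ^ h * b := by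
    obtain ⟨k, hk⟩ := Nat.exists_eq_add_of_le hah
    have h2 : 2 ^ h - 1 = b + k := by omega
    have h3 : 2 ^ h - 1 - b = k := by omega
    rw [h2, show b + k - b = k by omega, hk]; ring
  rw [h1, binaryWeight_add_two_pow_mul _ _ _ (by omega)]
  exact binaryWeight_complement h b (by omega)

/-- Doubling modulo 2^m - 1 rotates the m bits cyclically. -/
theorem binaryWeight_two_mul_mod {m j : ℕ} (hj : j < 2 ^ m - 1) :
    binaryWeight (2 * j % (2 ^ m - 1)) = binaryWeight j := by
  by_cases hlt : 2 * j < 2 ^ m - 1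
  · rw [Nat.mod_eq_of_lt hlt, binaryWeight_two_mul]
  · obtain ⟨k, rfl⟩ : ∃ k, m = k + 1 := by
      cases m with
      | zero => simp at hj
      | succ k => exact ⟨k, rfl⟩
    rw [pow_succ] at *
    obtain ⟨i, rfl⟩ : ∃ i, j = i + 2 ^ k * 1 := ⟨j - 2 ^ k, by omega⟩
    rw [binaryWeight_add_two_pow_mul _ _ _ (by omega), binaryWeight_one,
      Nat.mod_eq_sub_mod (by omega), Nat.mod_eq_of_lt (by omega),
      show 2 * (i + 2 ^ k * 1) - (2 ^ k * 2 - 1) = 2 * i + 1 by omega,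
      binaryWeight_two_mul_add_one]

end BinaryWeight

/-! ### Counting differences modulo four -/

section Counting

/-- If every nonzero element of a group of odd order is a difference of two elements of `E` in an
even number of ways and `E` has even size, then the size of `E` is divisible by four. -/
theorem four_dvd_card_of_even_differences {G : Type*} [AddCommGroup G] [Fintype G]
    [DecidableEq G] (hG : Odd (Fintype.card G)) (E : Finset G) (hE : Even E.card)
    (hN : ∀ δ : G, Even (E.filter (fun i => i + δ ∈ E)).card) : 4 ∣ E.card := by
  have hneg : ∀ δ : G, δ ≠ 0 → -δ ≠ δ := by
    intro δ hδ h
    have h2 : (2 : ℕ) • δ = 0 := by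
      rw [two_nsmul]; nth_rewrite 1 [← h]; exact neg_add_cancel δ
    have h3 : Fintype.card G • δ = 0 := card_nsmul_eq_zero
    obtain ⟨k, hk⟩ := hG
    rw [hk, add_nsmul, mul_comm, mul_nsmul', h2] at h3
    simp at h3
    exact hδ h3
  -- `f δ` is half the number of representations of δ as a difference.
  choose f hf using fun δ => hN δ
  have hsymm : ∀ δ, f (-δ) = f δ := by
    intro δ
    have : (E.filter (fun i => i + -δ ∈ E)).card = (E.filter (fun i => i + δ ∈ E)).card := by
      refine Finset.card_bij (fun i _ => i + -δ) ?_ ?_ ?_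
      · intro i hi; simp_all
      · intro i _ j _ h; simpa using h
      · intro i hi; refine ⟨i + δ, ?_, ?_⟩ <;> simp_all
    rw [hf, hf] at this; omega
  -- In odd order, δ ↦ -δ has no nonzero fixed point, so equal terms cancel in pairs modulo 2.
  have heven : Even (∑ δ ∈ Finset.univ.erase (0 : G), f δ) := by
    rw [← ZMod.natCast_eq_zero_iff_even, Nat.cast_sum]
    refine Finset.sum_involution (fun δ _ => -δ) ?_ ?_ ?_ ?_
    · intro δ _; rw [hsymm]; exact CharTwo.add_self_eq_zero _
    · intro δ hδ _; exact hneg δ (Finset.ne_of_mem_erase hδ)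
    · intro δ hδ; simpa using hδ
    · intro δ _; simp
  have htotal : ∑ δ : G, (E.filter (fun i => i + δ ∈ E)).card = E.card * E.card := by
    simp_rw [Finset.card_filter]
    rw [Finset.sum_comm]
    rw [← smul_eq_mul, ← Finset.sum_const]
    refine Finset.sum_congr rfl fun i _ => ?_
    rw [← Finset.card_filter]
    refine Finset.card_bij (fun δ _ => i + δ) ?_ ?_ ?_
    · intro δ hδ; simpa using hδ
    · intro δ _ δ' _ h; simpa using h
    · intro j hj; exact ⟨-i + j, by simpa using hj, by simp⟩
  rw [← Finset.add_sum_erase _ _ (Finset.mem_univ (0 : G))] at htotal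
  have h0 : (E.filter (fun i => i + 0 ∈ E)).card = E.card := by simp
  rw [h0, Finset.sum_congr rfl (fun δ _ => hf δ), ← Finset.sum_add_distrib.symm] at htotal
  obtain ⟨w, hw⟩ := hE
  obtain ⟨s, hs⟩ := heven
  rw [hs, hw] at htotal
  -- Ordered pairs in E, sorted by difference: δ = 0 gives |E| = 2w, the other δ give twice the even
  -- sum 2s.
  have h4 : 2 * w + 4 * s = 4 * (w * w) := by linarith
  omega

end Counting

/-! ### Polynomials with prescribed roots of unity -/

section RootPolynomial

variable {F : Type*} [Field F] {n : ℕ}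

/-- The monic polynomial with the simple roots `α ^ j`, `j ∈ T`. -/
noncomputable def rootPoly (α : F) (T : Finset ℕ) : F[X] := ∏ j ∈ T, (X - C (α ^ j))

theorem rootPoly_monic (α : F) (T : Finset ℕ) : (rootPoly α T).Monic :=
  monic_prod_of_monic _ _ fun _ _ => monic_X_sub_C _

theorem natDegree_rootPoly (α : F) (T : Finset ℕ) : (rootPoly α T).natDegree = T.card := by
  rw [rootPoly, natDegree_prod_of_monic _ _ fun _ _ => monic_X_sub_C _]
  simp_rw [natDegree_X_sub_C]
  simp

theorem rootPoly_dvd_iff {α : F} (hα : IsPrimitiveRoot α n) {T : Finset ℕ}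
    (hT : ∀ j ∈ T, j < n) (p : F[X]) : rootPoly α T ∣ p ↔ ∀ j ∈ T, p.eval (α ^ j) = 0 := by
  constructor
  · intro h j hj
    exact dvd_iff_isRoot.1 ((Finset.dvd_prod_of_mem (fun j => X - C (α ^ j)) hj).trans h)
  · intro h
    refine Finset.prod_dvd_of_coprime ?_ fun j hj => dvd_iff_isRoot.2 (h j hj)
    intro i hi j hj hij
    refine isCoprime_X_sub_C_of_isUnit_sub (sub_ne_zero.2 fun h => hij ?_).isUnit
    exact hα.pow_inj (hT i hi) (hT j hj) h

theorem isRoot_rootPoly_iff {α : F} (hα : IsPrimitiveRoot α n) {T : Finset ℕ}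
    (hT : ∀ j ∈ T, j < n) {i : ℕ} (hi : i < n) : (rootPoly α T).eval (α ^ i) = 0 ↔ i ∈ T := by
  rw [rootPoly, eval_prod, Finset.prod_eq_zero_iff]
  constructor
  · rintro ⟨j, hj, h⟩
    rw [eval_sub, eval_X, eval_C, sub_eq_zero] at h
    exact hα.pow_inj hi (hT j hj) h ▸ hj
  · intro h
    exact ⟨i, h, by simp⟩

theorem pow_val_add {β : F} (hβ : β ^ n = 1) (i k : Fin n) :
    β ^ ((i + k : Fin n) : ℕ) = β ^ (i : ℕ) * β ^ (k : ℕ) := by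
  rw [Fin.val_add, ← pow_add, ← pow_eq_pow_mod _ hβ]

theorem pow_pow_eq_one {α : F} (hα : IsPrimitiveRoot α n) (j : ℕ) : (α ^ j) ^ n = 1 := by
  rw [← pow_mul, mul_comm, pow_mul, hα.pow_eq_one, one_pow]

end RootPolynomial

/-! ### Cyclic codes described by their zeros -/

section WordPolynomial

variable {F : Type*} [Field F] [Algebra (ZMod 2) F] {n : ℕ}

/-- The polynomial `c₀ + c₁ x + ⋯ + c_{n-1} x ^ (n-1)` of a word. -/
noncomputable def wordPoly (n : ℕ) (c : Fin n → ZMod 2) : (ZMod 2)[X] :=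
  ∑ i : Fin n, Polynomial.monomial (i : ℕ) (c i)

/-- The value of the polynomial of the word `c` at `β`. -/
noncomputable def wordEval (β : F) (c : Fin n → ZMod 2) : F :=
  ∑ i : Fin n, algebraMap (ZMod 2) F (c i) * β ^ (i : ℕ)

theorem aeval_wordPoly (β : F) (c : Fin n → ZMod 2) : aeval β (wordPoly n c) = wordEval β c := by
  simp [wordPoly, wordEval, aeval_monomial]

theorem wordEval_one (c : Fin n → ZMod 2) :
    wordEval (1 : F) c = algebraMap (ZMod 2) F (∑ i, c i) := by
  simp [wordEval]

theorem degree_wordPoly_lt (c : Fin n → ZMod 2) : wordPoly n c ∈ degreeLT (ZMod 2) n := by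
  refine Submodule.sum_mem _ fun i _ => ?_
  rw [mem_degreeLT]
  exact (degree_monomial_le _ _).trans_lt (by exact_mod_cast i.2)

theorem coeff_wordPoly (c : Fin n → ZMod 2) (i : Fin n) : (wordPoly n c).coeff i = c i := by
  simp [wordPoly, finsetSum_coeff, coeff_monomial, Fin.val_inj]

theorem wordPoly_coeff {p : (ZMod 2)[X]} (hp : p ∈ degreeLT (ZMod 2) n) :
    wordPoly n (fun i => p.coeff i) = p := by
  rw [wordPoly, Fin.sum_univ_eq_sum_range (fun i => monomial i (p.coeff i)) n]
  rcases eq_or_ne p 0 with rfl | h0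
  · simp
  · refine (p.as_sum_range' n ?_).symm
    rw [mem_degreeLT] at hp
    exact (natDegree_lt_iff_degree_lt h0).2 hp

/-- Reduction modulo x^n - 1 does not affect divisibility by g, because g divides x^n - 1. -/
theorem mem_cyclicCode_iff_dvd {g : (ZMod 2)[X]} (hg : g ∣ X ^ n - 1) (c : Fin n → ZMod 2) :
    c ∈ cyclicCode n g ↔ g ∣ wordPoly n c := by
  have h : wordClass n c = Ideal.Quotient.mk (Ideal.span {(X ^ n - 1 : (ZMod 2)[X])})
      (wordPoly n c) := by
    simp [wordClass, wordPoly]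
  rw [cyclicCode, Submodule.mem_comap, Submodule.restrictScalars_mem, h,
    Ideal.mem_span_singleton]
  constructor
  · rintro ⟨q, hq⟩
    obtain ⟨q, rfl⟩ := Ideal.Quotient.mk_surjective q
    rw [← map_mul, Ideal.Quotient.eq, Ideal.mem_span_singleton] at hq
    exact (dvd_sub_left (dvd_mul_right g q)).1 (hg.trans hq)
  · rintro ⟨q, hq⟩
    rw [hq, map_mul]
    exact dvd_mul_right _ _

theorem dvd_X_pow_sub_one_of_map_eq {α : F} (hα : IsPrimitiveRoot α n) {T : Finset ℕ}
    (hT : ∀ j ∈ T, j < n) {g : (ZMod 2)[X]} (hg : g.map (algebraMap (ZMod 2) F) = rootPoly α T) :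
    g ∣ X ^ n - 1 := by
  rw [← map_dvd_map' (algebraMap (ZMod 2) F), hg, rootPoly_dvd_iff hα hT]
  intro j _
  simp [pow_pow_eq_one hα]

theorem monic_of_map_eq {α : F} {T : Finset ℕ} {g : (ZMod 2)[X]}
    (hg : g.map (algebraMap (ZMod 2) F) = rootPoly α T) : g.Monic := by
  have := rootPoly_monic α T
  rw [← hg] at this
  exact monic_of_injective (algebraMap (ZMod 2) F).injective this

theorem mem_cyclicCode_iff {α : F} (hα : IsPrimitiveRoot α n) {T : Finset ℕ}
    (hT : ∀ j ∈ T, j < n) {g : (ZMod 2)[X]} (hg : g.map (algebraMap (ZMod 2) F) = rootPoly α T)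
    (c : Fin n → ZMod 2) : c ∈ cyclicCode n g ↔ ∀ j ∈ T, wordEval (α ^ j) c = 0 := by
  rw [mem_cyclicCode_iff_dvd (dvd_X_pow_sub_one_of_map_eq hα hT hg),
    ← map_dvd_map' (algebraMap (ZMod 2) F), hg, rootPoly_dvd_iff hα hT]
  simp_rw [eval_map_algebraMap, aeval_wordPoly]

theorem hasDefiningSet_cyclicCode {α : F} [NeZero n] (hα : IsPrimitiveRoot α n) {T : Finset ℕ}
    (hT : ∀ j ∈ T, j < n) {g : (ZMod 2)[X]}
    (hg : g.map (algebraMap (ZMod 2) F) = rootPoly α T) :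
    HasDefiningSet α (cyclicCode n g) {i : ZMod n | i.val ∈ T} := by
  refine ⟨g, monic_of_map_eq hg, dvd_X_pow_sub_one_of_map_eq hα hT hg, rfl, ?_⟩
  ext i
  rw [Set.mem_ofPred_eq, Set.mem_ofPred_eq, ← isRoot_rootPoly_iff hα hT (ZMod.val_lt i), ← hg,
    eval_map_algebraMap]

/-- Multiplication by g maps the polynomials of degree below n - |T| bijectively onto the code. -/
theorem finrank_cyclicCode {α : F} (hα : IsPrimitiveRoot α n) {T : Finset ℕ}
    (hT : ∀ j ∈ T, j < n) {g : (ZMod 2)[X]}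
    (hg : g.map (algebraMap (ZMod 2) F) = rootPoly α T) :
    Module.finrank (ZMod 2) (cyclicCode n g) = n - T.card := by
  have hmonic := monic_of_map_eq hg
  have hdeg : g.natDegree = T.card := by
    rw [← natDegree_rootPoly α T, ← hg, natDegree_map]
  have hcard : T.card ≤ n := by
    simpa using Finset.card_le_card (fun j hj => Finset.mem_range.2 (hT j hj) : T ⊆ Finset.range n)
  have hdvd := dvd_X_pow_sub_one_of_map_eq hα hT hg
  have hmul : ∀ p : (ZMod 2)[X], p ∈ degreeLT (ZMod 2) (n - T.card) ↔
      g * p ∈ degreeLT (ZMod 2) n := by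
    intro p
    rcases eq_or_ne p 0 with rfl | hp
    · simp
    · rw [mem_degreeLT, mem_degreeLT, ← natDegree_lt_iff_degree_lt hp,
        ← natDegree_lt_iff_degree_lt (mul_ne_zero hmonic.ne_zero hp),
        natDegree_mul hmonic.ne_zero hp, hdeg]
      omega
  let L : degreeLT (ZMod 2) (n - T.card) →ₗ[ZMod 2] cyclicCode n g :=
    { toFun := fun p => ⟨fun i => (g * (p : (ZMod 2)[X])).coeff i, by
        rw [mem_cyclicCode_iff_dvd hdvd, wordPoly_coeff ((hmul _).1 p.2)]
        exact dvd_mul_right _ _⟩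
      map_add' := fun p q => by ext i; simp [mul_add]
      map_smul' := fun a p => by ext i; simp }
  have hL : Function.Bijective L := by
    constructor
    · intro p q h
      have h' : (fun i : Fin n => (g * (p : (ZMod 2)[X])).coeff i) =
          fun i : Fin n => (g * (q : (ZMod 2)[X])).coeff i := congrArg Subtype.val h
      have h2 := congrArg (wordPoly n) h'
      rw [wordPoly_coeff ((hmul _).1 p.2), wordPoly_coeff ((hmul _).1 q.2)] at h2
      exact Subtype.ext (mul_left_cancel₀ hmonic.ne_zero h2)
    · rintro ⟨c, hc⟩
      obtain ⟨q, hq⟩ := (mem_cyclicCode_iff_dvd hdvd c).1 hc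
      refine ⟨⟨q, (hmul q).2 (hq ▸ degree_wordPoly_lt c)⟩, Subtype.ext ?_⟩
      funext i
      change (g * q).coeff i = c i
      rw [← hq, coeff_wordPoly]
  rw [← (LinearEquiv.ofBijective L hL).finrank_eq, (degreeLTEquiv (ZMod 2) _).finrank_eq]
  simp

end WordPolynomial

/-! ### Fourier transform of words and the BCH bound -/

section Spectrum

variable {F : Type*} [Field F] [Algebra (ZMod 2) F] {n : ℕ}

theorem wordEval_translate [NeZero n] {β : F} (hβ : β ^ n = 1) (c : Fin n → ZMod 2)
    (δ : Fin n) : wordEval β (fun i => c (i + δ)) * β ^ (δ : ℕ) = wordEval β c := by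
  rw [wordEval, wordEval, Finset.sum_mul]
  refine Fintype.sum_equiv (Equiv.addRight δ) _ _ fun i => ?_
  rw [Equiv.coe_addRight, pow_val_add hβ, mul_assoc]

theorem wordEval_neg [NeZero n] {β γ : F} (hγ : γ ^ n = 1) (hβγ : β * γ = 1)
    (c : Fin n → ZMod 2) : wordEval β (fun i => c (-i)) = wordEval γ c := by
  rw [wordEval, wordEval]
  refine Fintype.sum_equiv (Equiv.neg (Fin n)) _ _ fun i => ?_
  have h := pow_val_add hγ (-i) i
  have h2 : β ^ (i : ℕ) * γ ^ (i : ℕ) = 1 := by rw [← mul_pow, hβγ, one_pow]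
  rw [neg_add_cancel, Fin.val_zero, pow_zero] at h
  rw [Equiv.neg_apply]
  congr 1
  exact mul_right_cancel₀ (right_ne_zero_of_mul_eq_one h2) (h2.trans h)

/-- Parseval's identity for binary words of odd length. -/
theorem algebraMap_dotProduct {α : F} (hα : IsPrimitiveRoot α n) (hn : Odd n)
    (a b : Fin n → ZMod 2) :
    algebraMap (ZMod 2) F (a ⬝ᵥ b) =
      ∑ j ∈ Finset.range n, wordEval (α ^ j) a * wordEval (α ^ (n - j)) b := by
  have hn0 : n ≠ 0 := hn.pos.ne'
  have hα0 : α ≠ 0 := hα.ne_zero hn0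
  have : CharP F 2 := charP_of_injective_algebraMap (algebraMap (ZMod 2) F).injective 2
  -- In characteristic 2 with n odd, the usual factor 1 / n is 1.
  have hncast : (n : F) = 1 := by
    obtain ⟨k, rfl⟩ := hn
    push_cast
    rw [CharTwo.two_eq_zero]; simp
  have hinv : ∀ j < n, ∀ k : ℕ, (α ^ (n - j)) ^ k = (α ^ j)⁻¹ ^ k := by
    intro j hj k
    congr 1
    refine eq_inv_of_mul_eq_one_left ?_
    rw [← pow_add, Nat.sub_add_cancel hj.le,
      hα.pow_eq_one]
  have horth : ∀ i k : Fin n, ∑ j ∈ Finset.range n, (α ^ j) ^ (i : ℕ) * (α ^ (n - j)) ^ (k : ℕ) =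
      if i = k then 1 else 0 := by
    intro i k
    have h1 : ∑ j ∈ Finset.range n, (α ^ j) ^ (i : ℕ) * (α ^ (n - j)) ^ (k : ℕ) =
        ∑ j ∈ Finset.range n, (α ^ (i : ℕ) / α ^ (k : ℕ)) ^ j := by
      refine Finset.sum_congr rfl fun j hj => ?_
      rw [hinv j (Finset.mem_range.1 hj), div_eq_mul_inv, mul_pow, inv_pow, inv_pow, ← pow_mul,
        ← pow_mul, ← pow_mul, ← pow_mul, mul_comm j, mul_comm j]
    rw [h1]
    split_ifs with h
    · subst h
      rw [div_self (pow_ne_zero _ hα0)]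
      simp [hncast]
    · have hne : α ^ (i : ℕ) / α ^ (k : ℕ) ≠ 1 := by
        rw [Ne, div_eq_one_iff_eq (pow_ne_zero _ hα0)]
        exact fun h' => h (Fin.ext (hα.pow_inj i.2 k.2 h'))
      rw [geom_sum_eq hne, div_pow, pow_pow_eq_one hα, pow_pow_eq_one hα]
      simp
  simp_rw [wordEval, Finset.sum_mul_sum]
  rw [Finset.sum_comm]
  simp_rw [Finset.sum_comm (s := Finset.range n)]
  have h2 : ∀ i k : Fin n, ∑ j ∈ Finset.range n, (algebraMap (ZMod 2) F (a i) * (α ^ j) ^ (i : ℕ)) *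
      (algebraMap (ZMod 2) F (b k) * (α ^ (n - j)) ^ (k : ℕ)) =
      if i = k then algebraMap (ZMod 2) F (a i) * algebraMap (ZMod 2) F (b k) else 0 := by
    intro i k
    rw [← mul_ite_zero, ← mul_boole, ← horth i k, Finset.mul_sum, Finset.mul_sum]
    refine Finset.sum_congr rfl fun j _ => by ring
  simp_rw [h2]
  simp [dotProduct]

/-- The BCH bound: a nonzero word vanishing at `β, β ^ 2, …, β ^ δ` has weight at least `δ + 1`. -/
theorem lt_hammingNorm_of_wordEval_eq_zero {β : F} (hβ : IsPrimitiveRoot β n) {δ : ℕ}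
    {c : Fin n → ZMod 2} (hc : c ≠ 0) (h : ∀ a, 1 ≤ a → a ≤ δ → wordEval (β ^ a) c = 0) :
    δ < hammingNorm c := by
  by_contra! hle
  obtain ⟨k, hk⟩ := Function.ne_iff.1 hc
  have hβ0 : β ≠ 0 := hβ.ne_zero (k.pos).ne'
  set E : Finset (Fin n) := Finset.univ.filter (fun i => c i ≠ 0) with hE
  have hkE : k ∈ E := by simpa [hE] using hk
  -- The product kills every support position except k. The factor X removes the constant term, so
  -- only β, …, β^δ are needed and not the value at 1.
  let q : F[X] := X * ∏ i ∈ E.erase k, (X - C (β ^ (i : ℕ)))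
  have hqdeg : q.natDegree ≤ δ := by
    refine natDegree_mul_le.trans ?_
    rw [natDegree_prod_of_monic _ _ fun _ _ => monic_X_sub_C _]
    simp only [natDegree_X, natDegree_X_sub_C, Finset.sum_const, smul_eq_mul, mul_one]
    have : E.card ≤ δ := hle
    have := Finset.card_erase_add_one hkE
    omega
  have hsum : ∑ i : Fin n, algebraMap (ZMod 2) F (c i) * q.eval (β ^ (i : ℕ)) = 0 := by
    simp_rw [eval_eq_sum_range, Finset.mul_sum]
    rw [Finset.sum_comm]
    refine Finset.sum_eq_zero fun a ha => ?_
    rcases Nat.eq_zero_or_pos a with rfl | ha0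
    · simp [q]
    · rw [← mul_zero (q.coeff a), ← h a ha0 (by have := Finset.mem_range.1 ha; omega), wordEval,
        Finset.mul_sum]
      refine Finset.sum_congr rfl fun i _ => ?_
      rw [← pow_mul, ← pow_mul, mul_comm a]; ring
  rw [Finset.sum_eq_single k] at hsum
  · have h1 : algebraMap (ZMod 2) F (c k) ≠ 0 := by
      rw [Ne, map_eq_zero]; exact hk
    have h2 := (mul_eq_zero.1 hsum).resolve_left h1
    simp only [q, eval_mul, eval_X, eval_prod, eval_sub, eval_C] at h2
    rcases mul_eq_zero.1 h2 with h3 | h3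
    · exact pow_ne_zero _ hβ0 h3
    · obtain ⟨i, hi, h4⟩ := Finset.prod_eq_zero_iff.1 h3
      exact Finset.ne_of_mem_erase hi (Fin.ext (hβ.pow_inj i.2 k.2 (sub_eq_zero.1 h4).symm))
  · intro i _ hik
    by_cases hi : c i = 0
    · simp [hi]
    · have hiE : i ∈ E.erase k := Finset.mem_erase.2 ⟨hik, by simpa [hE] using hi⟩
      have : q.eval (β ^ (i : ℕ)) = 0 := by
        simp only [q, eval_mul, eval_X, eval_prod, eval_sub, eval_C]
        rw [Finset.prod_eq_zero hiE (sub_self _), mul_zero]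
      rw [this, mul_zero]
  · simp

end Spectrum

/-! ### Distance, duality and extension of binary codes -/

section Codes

variable {n : ℕ}

theorem minDistance_eq_sInf_hammingNorm (C : BinaryCode n) :
    minDistance C = sInf {d : ℕ | ∃ c ∈ C, c ≠ 0 ∧ hammingNorm c = d} := by
  rw [minDistance]
  congr 1
  ext d
  constructor
  · rintro ⟨x, hx, y, hy, hxy, rfl⟩
    exact ⟨-x + y, C.add_mem (C.neg_mem hx) hy, fun h => hxy (neg_add_eq_zero.1 h),
      (hammingDist_eq_hammingNorm x y).symm⟩
  · rintro ⟨c, hc, h0, rfl⟩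
    exact ⟨c, hc, 0, C.zero_mem, h0, by simp⟩

/-- Positive dimension is needed because the infimum of the empty set is 0. -/
theorem le_minDistance {C : BinaryCode n} {d : ℕ} (hC : 0 < Module.finrank (ZMod 2) C)
    (h : ∀ c ∈ C, c ≠ 0 → d ≤ hammingNorm c) : d ≤ minDistance C := by
  rw [minDistance_eq_sInf_hammingNorm]
  have hne : C ≠ ⊥ := by
    rintro rfl
    simp at hC
  obtain ⟨c, hc, h0⟩ := C.ne_bot_iff.1 hne
  refine le_csInf ⟨_, c, hc, h0, rfl⟩ ?_
  rintro _ ⟨c, hc, h0, rfl⟩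
  exact h c hc h0

theorem minDistance_eq_of_hammingNorm {C C' : BinaryCode n}
    (h : ∀ c ∈ C, ∃ c' ∈ C', hammingNorm c' = hammingNorm c)
    (h' : ∀ c ∈ C', ∃ c' ∈ C, hammingNorm c' = hammingNorm c) :
    minDistance C = minDistance C' := by
  rw [minDistance_eq_sInf_hammingNorm, minDistance_eq_sInf_hammingNorm]
  congr 1
  ext d
  constructor
  · rintro ⟨c, hc, h0, rfl⟩
    obtain ⟨c', hc', hn⟩ := h c hc
    exact ⟨c', hc', hammingNorm_ne_zero_iff.1 (hn ▸ hammingNorm_ne_zero_iff.2 h0), hn⟩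
  · rintro ⟨c, hc, h0, rfl⟩
    obtain ⟨c', hc', hn⟩ := h' c hc
    exact ⟨c', hc', hammingNorm_ne_zero_iff.1 (hn ▸ hammingNorm_ne_zero_iff.2 h0), hn⟩

theorem hammingNorm_comp_equiv (σ : Equiv.Perm (Fin n)) (c : Fin n → ZMod 2) :
    hammingNorm (fun i => c (σ i)) = hammingNorm c := by
  refine Finset.card_bij (fun i _ => σ i) ?_ ?_ ?_
  · intro i hi; simpa using hi
  · intro i _ j _ h; simpa using h
  · intro i hi; exact ⟨σ.symm i, by simpa using hi, by simp⟩

theorem natCast_hammingNorm (c : Fin n → ZMod 2) :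
    ((hammingNorm c : ℕ) : ZMod 2) = ∑ i, c i := by
  rw [hammingNorm, Finset.card_filter]
  push_cast
  refine Finset.sum_congr rfl fun i _ => ?_
  generalize c i = x
  revert x
  decide

theorem even_hammingNorm_iff (c : Fin n → ZMod 2) : Even (hammingNorm c) ↔ ∑ i, c i = 0 := by
  rw [← natCast_hammingNorm, ZMod.natCast_eq_zero_iff_even]

theorem hammingNorm_succ (c : Fin (n + 1) → ZMod 2) :
    hammingNorm c = hammingNorm (fun i : Fin n => c i.castSucc) +
      if c (Fin.last n) ≠ 0 then 1 else 0 := by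
  rw [hammingNorm, hammingNorm, Finset.card_filter, Finset.card_filter, Fin.sum_univ_castSucc]

/-- The dot product identifies the dual code with the annihilator of C. -/
theorem finrank_dualCode (C : BinaryCode n) :
    Module.finrank (ZMod 2) (dualCode C) = n - Module.finrank (ZMod 2) C := by
  have h1 : (dualCode C).map (dotProductEquiv (ZMod 2) (Fin n)).toLinearMap =
      C.dualAnnihilator := by
    ext f
    obtain ⟨u, rfl⟩ := (dotProductEquiv (ZMod 2) (Fin n)).surjective f
    rw [Submodule.mem_map_equiv, LinearEquiv.symm_apply_apply, Submodule.mem_dualAnnihilator]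
    rfl
  have h2 := Subspace.finrank_add_finrank_dualAnnihilator_eq C
  rw [← h1, LinearEquiv.finrank_map_eq, Module.finrank_fin_fun] at h2
  omega

theorem finrank_extendedCode (C : BinaryCode n) :
    Module.finrank (ZMod 2) (extendedCode C) = Module.finrank (ZMod 2) C := by
  let L : extendedCode C →ₗ[ZMod 2] C :=
    { toFun := fun c => ⟨fun i => (c : Fin (n + 1) → ZMod 2) i.castSucc, c.2.1⟩
      map_add' := fun a b => rfl
      map_smul' := fun k a => rfl }
  refine (LinearEquiv.ofBijective L ⟨?_, ?_⟩).finrank_eq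
  · rw [← LinearMap.ker_eq_bot, LinearMap.ker_eq_bot']
    rintro ⟨c, hc, hsum⟩ h
    have h' : (fun i : Fin n => c i.castSucc) = 0 := congrArg Subtype.val h
    have h0 : ∀ i : Fin n, c i.castSucc = 0 := fun i => congrFun h' i
    rw [Fin.sum_univ_castSucc] at hsum
    simp only [h0, Finset.sum_const_zero, zero_add] at hsum
    refine Subtype.ext (funext fun i => ?_)
    exact Fin.lastCases hsum h0 i
  · rintro ⟨c, hc⟩
    refine ⟨⟨Fin.snoc c (∑ i, c i), ?_, ?_⟩, ?_⟩
    · simpa using hc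
    · rw [Fin.sum_univ_castSucc]
      simp only [Fin.snoc_castSucc, Fin.snoc_last]
      exact CharTwo.add_self_eq_zero _
    · refine Subtype.ext (funext fun i => ?_)
      simp [L]

theorem last_eq_sum_of_mem_extendedCode {C : BinaryCode n} {c : Fin (n + 1) → ZMod 2}
    (hc : c ∈ extendedCode C) : c (Fin.last n) = ∑ i : Fin n, c i.castSucc := by
  have h := hc.2
  rw [Fin.sum_univ_castSucc] at h
  exact (CharTwo.add_eq_zero.1 h).symm

/-- The extension of a code of dimension `k` and length `2 k - 1` is self-dual if the scalar product
of two codewords is the product of their parities. -/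
theorem isSelfDual_extendedCode {C : BinaryCode n}
    (hC : ∀ a ∈ C, ∀ b ∈ C, a ⬝ᵥ b = (∑ i, a i) * ∑ i, b i)
    (hdim : 2 * Module.finrank (ZMod 2) C = n + 1) : IsSelfDual (extendedCode C) := by
  refine Submodule.eq_of_le_of_finrank_eq ?_ ?_
  · intro a ha b hb
    -- The parity coordinates contribute the product of parities a second time, which cancels modulo
    -- 2.
    rw [dotProduct, Fin.sum_univ_castSucc, last_eq_sum_of_mem_extendedCode ha,
      last_eq_sum_of_mem_extendedCode hb, ← hC _ ha.1 _ hb.1]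
    exact CharTwo.add_self_eq_zero _
  · rw [finrank_dualCode, finrank_extendedCode]
    omega

/-- The product of c with its shift by δ counts, modulo 2, the pairs in the support with difference
δ. -/
theorem four_dvd_hammingNorm_of_shift_dotProduct [NeZero n] (hn : Odd n) {c : Fin n → ZMod 2}
    (hc : ∑ i, c i = 0) (h : ∀ δ : Fin n, (fun i => c (i + δ)) ⬝ᵥ c = 0) :
    4 ∣ hammingNorm c := by
  refine four_dvd_card_of_even_differences (by simpa using hn) _ ((even_hammingNorm_iff c).2 hc) ?_
  intro δ
  rw [← ZMod.natCast_eq_zero_iff_even, ← h δ, Finset.filter_filter, Finset.card_filter, dotProduct]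
  push_cast
  refine Finset.sum_congr rfl fun i _ => ?_
  simp only [Finset.mem_filter, Finset.mem_univ, true_and]
  have key : ∀ x y : ZMod 2, y * x = if x ≠ 0 ∧ y ≠ 0 then 1 else 0 := by decide
  rw [key]

theorem hammingNorm_add_one (c : Fin n → ZMod 2) : hammingNorm (c + 1) + hammingNorm c = n := by
  rw [hammingNorm, hammingNorm, Finset.card_filter, Finset.card_filter, ← Finset.sum_add_distrib]
  have : ∀ i, ((if (c + 1) i ≠ 0 then 1 else 0) + if c i ≠ 0 then 1 else 0) = 1 := by
    intro i
    rw [Pi.add_apply, Pi.one_apply]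
    generalize c i = x
    revert x
    decide
  rw [Finset.sum_congr rfl fun i _ => this i]
  simp

/-- The extension of a cyclic code of length `n ≡ 3 [MOD 4]` containing the all-one word is
doubly-even if the scalar product of two codewords is the product of their parities. -/
theorem isDoublyEven_extendedCode [NeZero n] (hn : n % 4 = 3) {C : BinaryCode n}
    (hC : ∀ a ∈ C, ∀ b ∈ C, a ⬝ᵥ b = (∑ i, a i) * ∑ i, b i)
    (hshift : ∀ c ∈ C, ∀ δ : Fin n, (fun i => c (i + δ)) ∈ C) (hone : 1 ∈ C) :
    IsDoublyEven (extendedCode C) := by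
  have hodd : Odd n := Nat.odd_iff.2 (by omega)
  have heven : ∀ c ∈ C, ∑ i, c i = 0 → 4 ∣ hammingNorm c := by
    intro c hc hsum
    refine four_dvd_hammingNorm_of_shift_dotProduct hodd hsum fun δ => ?_
    rw [hC _ (hshift c hc δ) _ hc, hsum, mul_zero]
  intro c hc
  rw [hammingNorm_succ, last_eq_sum_of_mem_extendedCode hc]
  set a : Fin n → ZMod 2 := fun i => c i.castSucc with ha
  have haC : a ∈ C := hc.1
  by_cases hsum : ∑ i, a i = 0
  · simpa [hsum] using heven a haC hsum
  -- The complement of an odd-weight word has even weight, hence divisible by 4. Thus a has weight ≡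
  -- n ≡ 3 mod 4, and the parity bit completes it to a multiple of 4.
  · have hw := hammingNorm_add_one a
    have hodd' : ¬ Even (hammingNorm a) := fun h => hsum ((even_hammingNorm_iff a).1 h)
    have hev : Even (hammingNorm (a + 1)) := by
      rw [Nat.even_iff] at *; omega
    have := heven _ (C.add_mem haC hone) ((even_hammingNorm_iff _).1 hev)
    rw [if_pos hsum]
    omega

end Codes

/-! ### Duality and reversal when -1 gives the splitting -/

section Splitting

variable {F : Type*} [Field F] [Algebra (ZMod 2) F] {n : ℕ} {α : F} {T : Finset ℕ}

/-- T and its negative n - T partition the nonzero residues. -/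
theorem card_of_splitting (hT : ∀ j ∈ T, 1 ≤ j ∧ j < n)
    (hneg : ∀ j, 1 ≤ j → j < n → (j ∈ T ↔ n - j ∉ T)) : 2 * T.card = n - 1 := by
  have h1 : (T.image (fun j => n - j)).card = T.card := by
    refine Finset.card_image_of_injOn fun i hi j hj h => ?_
    have := hT i hi
    have := hT j hj
    have h : n - i = n - j := h
    omega
  have h2 : Finset.Icc 1 (n - 1) = T ∪ T.image (fun j => n - j) := by
    ext j
    simp only [Finset.mem_Icc, Finset.mem_union, Finset.mem_image]
    constructor
    · rintro ⟨hj1, hj2⟩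
      by_cases hj : j ∈ T
      · exact Or.inl hj
      · refine Or.inr ⟨n - j, ?_, by omega⟩
        rwa [hneg j hj1 (by omega), not_not] at hj
    · rintro (hj | ⟨i, hi, rfl⟩)
      · have := hT j hj; omega
      · have := hT i hi; omega
  have h3 : Disjoint T (T.image (fun j => n - j)) := by
    rw [Finset.disjoint_left]
    intro j hj hj'
    obtain ⟨i, hi, rfl⟩ := Finset.mem_image.1 hj'
    have := hT i hi
    rw [hneg _ (by omega) (by omega), show n - (n - i) = i by omega] at hj
    exact hj hi
  have h4 := congrArg Finset.card h2
  rw [Finset.card_union_of_disjoint h3, h1, Nat.card_Icc] at h4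
  omega

/-- In Parseval's sum each j ≠ 0 has j or -j among the common zeros, so only the term j = 0, the
product of the parities, survives. -/
theorem dotProduct_of_wordEval_eq_zero (hα : IsPrimitiveRoot α n) (hn : Odd n)
    (hneg : ∀ j, 1 ≤ j → j < n → (j ∈ T ↔ n - j ∉ T)) {a b : Fin n → ZMod 2}
    (ha : ∀ j ∈ T, wordEval (α ^ j) a = 0) (hb : ∀ j ∈ T, wordEval (α ^ j) b = 0) :
    a ⬝ᵥ b = (∑ i, a i) * ∑ i, b i := by
  apply (algebraMap (ZMod 2) F).injective
  rw [algebraMap_dotProduct hα hn, Finset.sum_eq_single 0]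
  · rw [Nat.sub_zero, pow_zero, hα.pow_eq_one, wordEval_one, wordEval_one, map_mul]
  · intro j hj hj0
    have hjn := Finset.mem_range.1 hj
    by_cases hjT : j ∈ T
    · rw [ha j hjT, zero_mul]
    · rw [hneg j (by omega) hjn, not_not] at hjT
      rw [hb _ hjT, mul_zero]
  · intro h
    exact absurd (Finset.mem_range.2 hn.pos) h

theorem wordEval_all_one {β : F} (hβ : β ^ n = 1) (hβ1 : β ≠ 1) :
    wordEval β (1 : Fin n → ZMod 2) = 0 := by
  simp only [wordEval, Pi.one_apply, map_one, one_mul]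
  rw [Fin.sum_univ_eq_sum_range (fun i => β ^ i) n, geom_sum_eq hβ1, hβ, sub_self, zero_div]

theorem map_X_sub_one_mul {g : (ZMod 2)[X]} (hg : g.map (algebraMap (ZMod 2) F) = rootPoly α T)
    (h0 : 0 ∉ T) : ((X - 1) * g).map (algebraMap (ZMod 2) F) = rootPoly α (insert 0 T) := by
  rw [rootPoly, Finset.prod_insert h0, Polynomial.map_mul, hg, rootPoly]
  simp

theorem mem_cyclicCode_X_sub_one_mul_iff (hα : IsPrimitiveRoot α n) (hn : 0 < n)
    (hT : ∀ j ∈ T, 1 ≤ j ∧ j < n)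
    {g : (ZMod 2)[X]} (hg : g.map (algebraMap (ZMod 2) F) = rootPoly α T) (c : Fin n → ZMod 2) :
    c ∈ cyclicCode n ((X - 1) * g) ↔ c ∈ cyclicCode n g ∧ ∑ i, c i = 0 := by
  have h0 : 0 ∉ T := fun h => by simpa using (hT 0 h).1
  rw [mem_cyclicCode_iff hα (fun j hj => (hT j hj).2) hg,
    mem_cyclicCode_iff hα (T := insert 0 T) _ (map_X_sub_one_mul hg h0), Finset.forall_mem_insert,
    pow_zero, wordEval_one, map_eq_zero, and_comm]
  intro j hj
  rcases Finset.mem_insert.1 hj with rfl | hj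
  · exact hn
  · exact (hT j hj).2

/-- The dual of an odd-like duadic code with splitting given by `-1` is its even-weight subcode. -/
theorem dualCode_cyclicCode (hα : IsPrimitiveRoot α n) (hn : Odd n)
    (hT : ∀ j ∈ T, 1 ≤ j ∧ j < n) (hneg : ∀ j, 1 ≤ j → j < n → (j ∈ T ↔ n - j ∉ T))
    {g : (ZMod 2)[X]} (hg : g.map (algebraMap (ZMod 2) F) = rootPoly α T) :
    dualCode (cyclicCode n g) = cyclicCode n ((X - 1) * g) := by
  have h0 : 0 ∉ T := fun h => by simpa using (hT 0 h).1
  have hT' : ∀ j ∈ T, j < n := fun j hj => (hT j hj).2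
  symm
  refine Submodule.eq_of_le_of_finrank_eq ?_ ?_
  · intro a ha b hb
    rw [mem_cyclicCode_X_sub_one_mul_iff hα hn.pos hT hg] at ha
    rw [dotProduct_of_wordEval_eq_zero hα hn hneg ((mem_cyclicCode_iff hα hT' hg a).1 ha.1)
      ((mem_cyclicCode_iff hα hT' hg b).1 hb), ha.2, zero_mul]
  · have hcard := card_of_splitting hT hneg
    have hpos := hn.pos
    rw [finrank_dualCode, finrank_cyclicCode hα hT' hg,
      finrank_cyclicCode hα (T := insert 0 T) _ (map_X_sub_one_mul hg h0),
      Finset.card_insert_of_notMem h0]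
    · obtain ⟨k, rfl⟩ := hn
      omega
    · intro j hj
      rcases Finset.mem_insert.1 hj with rfl | hj
      · exact hpos
      · exact hT' j hj

theorem isSelfDual_extendedCode_cyclicCode (hα : IsPrimitiveRoot α n) (hn : Odd n)
    (hT : ∀ j ∈ T, 1 ≤ j ∧ j < n) (hneg : ∀ j, 1 ≤ j → j < n → (j ∈ T ↔ n - j ∉ T))
    {g : (ZMod 2)[X]} (hg : g.map (algebraMap (ZMod 2) F) = rootPoly α T) :
    IsSelfDual (extendedCode (cyclicCode n g)) := by
  have hT' : ∀ j ∈ T, j < n := fun j hj => (hT j hj).2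
  refine isSelfDual_extendedCode (fun a ha b hb => ?_) ?_
  · exact dotProduct_of_wordEval_eq_zero hα hn hneg ((mem_cyclicCode_iff hα hT' hg a).1 ha)
      ((mem_cyclicCode_iff hα hT' hg b).1 hb)
  · have hcard := card_of_splitting hT hneg
    obtain ⟨k, rfl⟩ := hn
    rw [finrank_cyclicCode hα hT' hg]
    omega

theorem isDoublyEven_extendedCode_cyclicCode (hα : IsPrimitiveRoot α n) (hn : n % 4 = 3)
    (hT : ∀ j ∈ T, 1 ≤ j ∧ j < n) (hneg : ∀ j, 1 ≤ j → j < n → (j ∈ T ↔ n - j ∉ T))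
    {g : (ZMod 2)[X]} (hg : g.map (algebraMap (ZMod 2) F) = rootPoly α T) :
    IsDoublyEven (extendedCode (cyclicCode n g)) := by
  have hT' : ∀ j ∈ T, j < n := fun j hj => (hT j hj).2
  have hodd : Odd n := Nat.odd_iff.2 (by omega)
  have : NeZero n := ⟨hodd.pos.ne'⟩
  refine isDoublyEven_extendedCode hn (fun a ha b hb => ?_) (fun c hc δ => ?_) ?_
  · exact dotProduct_of_wordEval_eq_zero hα hodd hneg ((mem_cyclicCode_iff hα hT' hg a).1 ha)
      ((mem_cyclicCode_iff hα hT' hg b).1 hb)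
  · rw [mem_cyclicCode_iff hα hT' hg] at hc ⊢
    intro j hj
    have h := wordEval_translate (pow_pow_eq_one hα j) c δ
    rw [hc j hj] at h
    exact (mul_eq_zero.1 h).resolve_right
      (pow_ne_zero _ (pow_ne_zero _ (hα.ne_zero hodd.pos.ne')))
  · rw [mem_cyclicCode_iff hα hT' hg]
    intro j hj
    refine wordEval_all_one (pow_pow_eq_one hα j) (hα.pow_ne_one_of_pos_of_lt ?_ (hT j hj).2)
    have := (hT j hj).1
    omega

/-- Reversal of the coordinates carries the cyclic code with zeros `T` to the one with
zeros `-T`. -/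
theorem reverse_mem_cyclicCode [NeZero n] (hα : IsPrimitiveRoot α n) {T' : Finset ℕ}
    (hT : ∀ j ∈ T, j < n) (hT' : ∀ j ∈ T', j < n) (hTT' : ∀ j ∈ T', n - j ∈ T)
    {g g' : (ZMod 2)[X]} (hg : g.map (algebraMap (ZMod 2) F) = rootPoly α T)
    (hg' : g'.map (algebraMap (ZMod 2) F) = rootPoly α T') {c : Fin n → ZMod 2}
    (hc : c ∈ cyclicCode n g) : (fun i => c (-i)) ∈ cyclicCode n g' := by
  rw [mem_cyclicCode_iff hα hT hg] at hc
  rw [mem_cyclicCode_iff hα hT' hg']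
  intro j hj
  rw [wordEval_neg (γ := α ^ (n - j)) (pow_pow_eq_one hα _), hc _ (hTT' j hj)]
  rw [← pow_add, Nat.add_sub_cancel' (hT' j hj).le, hα.pow_eq_one]

end Splitting

/-! ### Descent to the prime field -/

section Descent

variable {F : Type*} [Field F] [Algebra (ZMod 2) F] {n : ℕ} {α : F} {T : Finset ℕ}

/-- If the exponents are closed under doubling, the polynomial has coefficients in `𝔽₂`. -/
theorem exists_map_eq_rootPoly (hα : α ^ n = 1) (hn : Odd n) (hT : ∀ j ∈ T, j < n)
    (hdouble : ∀ j ∈ T, 2 * j % n ∈ T) :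
    ∃ g : (ZMod 2)[X], g.map (algebraMap (ZMod 2) F) = rootPoly α T := by
  have : CharP F 2 := charP_of_injective_algebraMap (algebraMap (ZMod 2) F).injective 2
  have hinj : Set.InjOn (fun j => 2 * j % n) T := by
    intro i hi j hj h
    have h1 : 2 * i ≡ 2 * j [MOD n] := h
    have h2 : i ≡ j [MOD n] :=
      Nat.ModEq.cancel_left_of_coprime (Nat.coprime_two_right.2 hn) h1
    exact h2.eq_of_lt_of_lt (hT i hi) (hT j hj)
  have himage : T.image (fun j => 2 * j % n) = T := by
    refine Finset.eq_of_subset_of_card_le ?_ (Finset.card_image_of_injOn hinj).ge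
    intro j hj
    obtain ⟨i, hi, rfl⟩ := Finset.mem_image.1 hj
    exact hdouble i hi
  -- Frobenius permutes the roots, so each coefficient satisfies x² = x and is 0 or 1.
  have hfrob : (rootPoly α T).map (frobenius F 2) = rootPoly α T := by
    nth_rewrite 2 [← himage]
    rw [rootPoly, rootPoly, Finset.prod_image hinj, Polynomial.map_prod]
    refine Finset.prod_congr rfl fun j _ => ?_
    rw [Polynomial.map_sub, map_X, map_C, frobenius_def, ← pow_mul, mul_comm j,
      ← pow_eq_pow_mod _ hα]
  refine (mem_lifts _).1 ((lifts_iff_coeff_lifts _).2 fun i => ?_)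
  have h := congrArg (fun p => p.coeff i) hfrob
  simp only [coeff_map, frobenius_def] at h
  generalize (rootPoly α T).coeff i = x at h
  have h2 : x * (x - 1) = 0 := by rw [mul_sub, ← sq, h, mul_one, sub_self]
  rcases mul_eq_zero.1 h2 with h3 | h3
  · exact ⟨0, by rw [map_zero, h3]⟩
  · exact ⟨1, by rw [map_one, sub_eq_zero.1 h3]⟩

end Descent

/-! ### The splitting of ℤ / n -/

section Duadic

variable {n : ℕ} {T T' : Finset ℕ}

theorem setOf_val_mem_insert_zero :
    {i : ZMod n | i.val ∈ insert 0 T} = {0} ∪ {i : ZMod n | i.val ∈ T} := by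
  ext i
  simp [ZMod.val_eq_zero]

variable [NeZero n]

theorem val_mul_two (s : ZMod n) : (s * 2).val = 2 * s.val % n := by
  have : s * 2 = ((2 * s.val : ℕ) : ZMod n) := by
    push_cast
    rw [ZMod.natCast_val, ZMod.cast_id, mul_comm]
  rw [this, ZMod.val_natCast]

theorem isUnionOfCosets_of_doubling (hdouble : ∀ j ∈ T, 2 * j % n ∈ T) :
    IsUnionOfCosets {i : ZMod n | i.val ∈ T} := by
  intro s hs k
  induction k with
  | zero => simpa using hs
  | succ k ih =>
    rw [pow_succ, ← mul_assoc, Set.mem_ofPred_eq, val_mul_two]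
    exact hdouble _ ih

theorem isSplitting_neg_one (hT : ∀ j ∈ T, 1 ≤ j ∧ j < n) (hT' : ∀ j ∈ T', 1 ≤ j ∧ j < n)
    (hcompl : ∀ j, 1 ≤ j → j < n → (j ∈ T' ↔ j ∉ T))
    (hneg : ∀ j, 1 ≤ j → j < n → (j ∈ T ↔ n - j ∈ T'))
    (hdouble : ∀ j ∈ T, 2 * j % n ∈ T) (hdouble' : ∀ j ∈ T', 2 * j % n ∈ T') :
    IsSplitting {i : ZMod n | i.val ∈ T} {i : ZMod n | i.val ∈ T'} (-1) := by
  -- Zero is excluded: its negative has representative 0, not n.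
  have hval : ∀ i : ZMod n, 1 ≤ i.val → (-i).val = n - i.val := by
    intro i hi
    rw [ZMod.neg_val, if_neg]
    rintro rfl
    simp at hi
  have himage : ∀ A B : Finset ℕ, (∀ j ∈ A, 1 ≤ j ∧ j < n) → (∀ j ∈ B, 1 ≤ j ∧ j < n) →
      (∀ j, 1 ≤ j → j < n → (j ∈ A ↔ n - j ∈ B)) →
      (fun s => s * (((-1 : (ZMod n)ˣ)) : ZMod n)) '' {i : ZMod n | i.val ∈ A} =
        {i : ZMod n | i.val ∈ B} := by
    intro A B hA hB hAB
    ext i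
    simp only [Units.val_neg, Units.val_one, mul_neg, mul_one, Set.mem_image, Set.mem_ofPred_eq]
    constructor
    · rintro ⟨j, hj, rfl⟩
      have h := hA _ hj
      rw [hval j h.1]
      exact (hAB _ h.1 h.2).1 hj
    · intro hi
      have h := hB _ hi
      refine ⟨-i, ?_, neg_neg i⟩
      rw [hval i h.1, hAB _ (by omega) (by omega), show n - (n - i.val) = i.val by omega]
      exact hi
  refine ⟨isUnionOfCosets_of_doubling hdouble, isUnionOfCosets_of_doubling hdouble', ?_, ?_,
    himage T T' hT hT' hneg, himage T' T hT' hT ?_⟩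
  · ext i
    simp only [Set.mem_union, Set.mem_ofPred_eq, Set.mem_sdiff, Set.mem_univ, true_and,
      Set.mem_singleton_iff]
    rw [← ZMod.val_eq_zero]
    have hlt := ZMod.val_lt i
    constructor
    · rintro (h | h)
      · have := hT _ h; omega
      · have := hT' _ h; omega
    · intro h
      rw [hcompl _ (by omega) hlt]
      exact em _
  · ext i
    simp only [Set.mem_inter_iff, Set.mem_ofPred_eq, Set.mem_empty_iff_false, iff_false, not_and]
    intro h h'
    have := hT _ h
    exact (hcompl _ this.1 this.2).1 h' h
  · intro j h1 h2
    rw [hcompl j h1 h2, hneg j h1 h2, hcompl _ (by omega) (by omega), not_not]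

end Duadic

/-! ### Distance gains from doubly-evenness -/

section ExtendedDistance

variable {n : ℕ} {C : BinaryCode n} {D : ℕ}

theorem restrict_ne_zero_of_mem_extendedCode {c : Fin (n + 1) → ZMod 2}
    (hc : c ∈ extendedCode C) (h0 : c ≠ 0) : (fun i : Fin n => c i.castSucc) ≠ 0 := by
  intro h
  have h1 : ∀ i : Fin n, c i.castSucc = 0 := fun i => congrFun h i
  have h2 := last_eq_sum_of_mem_extendedCode hc
  simp only [h1, Finset.sum_const_zero] at h2
  exact h0 (funext fun i => Fin.lastCases h2 h1 i)

theorem add_four_le_hammingNorm_of_mem_extendedCode (hC : IsDoublyEven (extendedCode C))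
    (hD : ∀ c ∈ C, c ≠ 0 → D < hammingNorm c) (h4 : 4 ∣ D) :
    ∀ c ∈ extendedCode C, c ≠ 0 → D + 4 ≤ hammingNorm c := by
  intro c hc h0
  have h1 := hD _ hc.1 (restrict_ne_zero_of_mem_extendedCode hc h0)
  have h2 := hC c hc
  rw [hammingNorm_succ] at h2 ⊢
  omega

/-- The extension has weight at least the next multiple of 4 after D, and the parity bit accounts
for at most 1 of it. -/
theorem add_three_le_hammingNorm (hC : IsDoublyEven (extendedCode C))
    (hD : ∀ c ∈ C, c ≠ 0 → D < hammingNorm c) (h4 : 4 ∣ D) :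
    ∀ c ∈ C, c ≠ 0 → D + 3 ≤ hammingNorm c := by
  intro c hc h0
  have hmem : (Fin.snoc c (∑ i, c i) : Fin (n + 1) → ZMod 2) ∈ extendedCode C := by
    refine ⟨by simpa using hc, ?_⟩
    rw [Fin.sum_univ_castSucc]
    simp only [Fin.snoc_castSucc, Fin.snoc_last]
    exact CharTwo.add_self_eq_zero _
  have h1 := hC _ hmem
  have h2 := hD c hc h0
  rw [hammingNorm_succ] at h1
  simp only [Fin.snoc_castSucc, Fin.snoc_last] at h1
  change 4 ∣ hammingNorm c + _ at h1
  split_ifs at h1 <;> omega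

theorem exists_reverse_mem_extendedCode [NeZero n] {C' : BinaryCode n}
    (h : ∀ c ∈ C, (fun i => c (-i)) ∈ C') :
    ∀ c ∈ extendedCode C, ∃ c' ∈ extendedCode C', hammingNorm c' = hammingNorm c := by
  intro c hc
  refine ⟨Fin.snoc (fun i : Fin n => c (Fin.castSucc (-i))) (c (Fin.last n)), ⟨?_, ?_⟩, ?_⟩
  · simpa using h _ hc.1
  · rw [← hc.2, Fin.sum_univ_castSucc, Fin.sum_univ_castSucc]
    simp only [Fin.snoc_castSucc, Fin.snoc_last]
    congr 1
    exact Equiv.sum_comp (Equiv.neg (Fin n)) (fun i : Fin n => c i.castSucc)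
  · rw [hammingNorm_succ, hammingNorm_succ]
    simp only [Fin.snoc_castSucc, Fin.snoc_last]
    congr 1
    exact hammingNorm_comp_equiv (Equiv.neg (Fin n)) fun i => c i.castSucc

theorem minDistance_eq_of_reverse [NeZero n] {C' : BinaryCode n}
    (h : ∀ c ∈ C, (fun i => c (-i)) ∈ C') (h' : ∀ c ∈ C', (fun i => c (-i)) ∈ C) :
    minDistance C = minDistance C' :=
  minDistance_eq_of_hammingNorm
    (fun c hc => ⟨_, h c hc, hammingNorm_comp_equiv (Equiv.neg (Fin n)) c⟩)
    (fun c hc => ⟨_, h' c hc, hammingNorm_comp_equiv (Equiv.neg (Fin n)) c⟩)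

end ExtendedDistance

/-! ### Arithmetic of the defining sets -/

section WeightSet

variable {r m : ℕ} {S : Set (ZMod r)}

theorem mem_weightSet {j : ℕ} : j ∈ weightSet r m S ↔
    (1 ≤ j ∧ j < 2 ^ m - 1) ∧ ((binaryWeight j : ℕ) : ZMod r) ∈ S := by
  classical
  rw [weightSet, Finset.mem_filter, Finset.mem_Icc]
  refine and_congr_left fun _ => ?_
  omega

theorem mem_weightSet_compl {j : ℕ} (h1 : 1 ≤ j) (h2 : j < 2 ^ m - 1) :
    j ∈ weightSet r m Sᶜ ↔ j ∉ weightSet r m S := by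
  rw [mem_weightSet, mem_weightSet]
  simp [h1, h2]

theorem two_mul_mod_mem_weightSet (hm : 0 < m) {j : ℕ} (hj : j ∈ weightSet r m S) :
    2 * j % (2 ^ m - 1) ∈ weightSet r m S := by
  rw [mem_weightSet] at hj ⊢
  obtain ⟨⟨h1, h2⟩, h3⟩ := hj
  rw [binaryWeight_two_mul_mod h2]
  -- Oddness of the modulus keeps the doubled exponent nonzero.
  have hodd : Nat.Coprime (2 ^ m - 1) 2 := by
    rw [Nat.coprime_two_right]
    exact Nat.Even.sub_odd Nat.one_le_two_pow (Nat.even_pow.2 ⟨even_two, hm.ne'⟩) odd_one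
  refine ⟨⟨Nat.pos_of_ne_zero fun h0 => ?_, Nat.mod_lt _ (by omega)⟩, h3⟩
  have h4 := Nat.le_of_dvd h1 (hodd.dvd_of_dvd_mul_left (Nat.dvd_of_mod_eq_zero h0))
  omega

theorem mem_weightSet_iff_sub {x : ZMod r} (hx : (m : ZMod r) = x)
    (hS : ∀ i, i ∈ S ↔ x - i ∉ S) {j : ℕ} (h1 : 1 ≤ j) (h2 : j < 2 ^ m - 1) :
    j ∈ weightSet r m S ↔ 2 ^ m - 1 - j ∉ weightSet r m S := by
  have h3 := binaryWeight_complement m j (by omega)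
  have h4 : ((binaryWeight (2 ^ m - 1 - j) : ℕ) : ZMod r) = x - (binaryWeight j : ℕ) := by
    rw [eq_sub_iff_add_eq, ← hx]
    exact_mod_cast congrArg (Nat.cast : ℕ → ZMod r) h3
  rw [mem_weightSet, mem_weightSet, h4, hS]
  have h5 : 1 ≤ 2 ^ m - 1 - j := by omega
  have h6 : 2 ^ m - 1 - j < 2 ^ m - 1 := by omega
  simp [h1, h2, h5, h6]

/-- The injection i ↦ x - i sends S into its complement, which also has r / 2 elements, so it is
onto. -/
theorem mem_iff_sub_notMem_of_ncard (hr : 0 < r) (hr_even : Even r) {x : ZMod r}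
    (hcard : S.ncard = r / 2) (hS : ∀ i ∈ S, x - i ∈ Sᶜ) (i : ZMod r) : i ∈ S ↔ x - i ∉ S := by
  have : NeZero r := ⟨hr.ne'⟩
  have himage : (fun i => x - i) '' S = Sᶜ := by
    refine Set.eq_of_subset_of_ncard_le ?_ ?_
    · rintro _ ⟨i, hi, rfl⟩
      exact hS i hi
    · rw [Set.ncard_image_of_injective _ sub_right_injective, Set.ncard_compl, Nat.card_zmod, hcard]
      obtain ⟨k, rfl⟩ := hr_even
      omega
  refine ⟨hS i, fun h => ?_⟩
  have h' : x - i ∈ (fun i => x - i) '' S := himage ▸ h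
  obtain ⟨k, hk, hki⟩ := h'
  rwa [← sub_right_injective hki]

/-- The weight set contains `2 ^ h` consecutive multiples of `2 ^ k - 1` for `k = h` and for
`k = h + 1`, as soon as `k` reduces into `S`. -/
theorem mul_mem_weightSet {h k a : ℕ} (hh : 0 < h) (hk0 : 0 < k) (hk : k = h ∨ k = h + 1)
    (hkS : (k : ZMod r) ∈ S) (ha : 1 ≤ a) (hah : a ≤ 2 ^ h) :
    a * (2 ^ k - 1) ∈ weightSet r (2 * h + 1) S := by
  have hhk : 2 ^ h ≤ 2 ^ k := Nat.pow_le_pow_right (by norm_num) (by omega)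
  have hk' : 2 ^ k ≤ 2 ^ (h + 1) := Nat.pow_le_pow_right (by norm_num) (by omega)
  have hk1 : 2 ≤ 2 ^ k := Nat.le_self_pow hk0.ne' 2
  have hh1 : 2 ≤ 2 ^ h := Nat.le_self_pow hh.ne' 2
  rw [mem_weightSet, binaryWeight_mul_two_pow_sub_one ha (hah.trans hhk)]
  refine ⟨⟨Nat.mul_pos ha (by omega), ?_⟩, hkS⟩
  -- The largest case, a = 2^h and k = h + 1, equals 2^m - 2^h with m = 2h + 1; it is below 2^m - 1
  -- because 2^h ≥ 2.
  have h1 : a * (2 ^ k - 1) ≤ 2 ^ h * (2 ^ (h + 1) - 1) := Nat.mul_le_mul hah (by omega)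
  have h2 : 2 ^ h * (2 ^ (h + 1) - 1) = 2 ^ (2 * h + 1) - 2 ^ h := by
    rw [Nat.mul_sub, ← pow_add, mul_one]; congr 2; ring
  have h3 : 2 ^ h < 2 ^ (2 * h + 1) := Nat.pow_lt_pow_right (by norm_num) (by omega)
  omega

/-- The gcd is 2^gcd(k, 2h+1) - 1, and 2h + 1 differs by 1 from both 2h and 2(h + 1). -/
theorem coprime_two_pow_sub_one {h k : ℕ} (hk : k = h ∨ k = h + 1) :
    Nat.Coprime (2 ^ k - 1) (2 ^ (2 * h + 1) - 1) := by
  have h1 : Nat.gcd k (2 * h + 1) = 1 := by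
    rcases hk with rfl | rfl
    · have := Nat.gcd_dvd_left k (2 * k + 1)
      have h2 := Nat.gcd_dvd_right k (2 * k + 1)
      exact Nat.dvd_one.1 ((Nat.dvd_add_right (this.mul_left 2)).1 h2)
    · have := Nat.gcd_dvd_left (h + 1) (2 * h + 1)
      have h2 := Nat.gcd_dvd_right (h + 1) (2 * h + 1)
      refine Nat.dvd_one.1 ((Nat.dvd_add_right h2).1 ?_)
      exact (show 2 * h + 1 + 1 = 2 * (h + 1) by ring) ▸ this.mul_left 2
  rw [Nat.Coprime, Nat.pow_sub_one_gcd_pow_sub_one, h1, pow_one]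

end WeightSet

/-! ### Consequences of the residue hypotheses -/

/-- The half `h` of `m - 1`, or `h + 1`, lies in `S` when `S` contains the residues of `(t - 1) / 2`
and `(t + r + 1) / 2` or those of `(t + 1) / 2` and `(t + r - 1) / 2`. -/
theorem exists_half_mem {r h : ℕ} {t : ℤ} {S : Set (ZMod r)} (hr_even : Even r) (ht : Odd t)
    (hmt : ((2 * h + 1 : ℕ) : ℤ) ≡ t [ZMOD r])
    (hS : ((((t - 1) / 2 : ℤ) : ZMod r) ∈ S ∧ (((t + r + 1) / 2 : ℤ) : ZMod r) ∈ S) ∨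
      ((((t + 1) / 2 : ℤ) : ZMod r) ∈ S ∧ (((t + r - 1) / 2 : ℤ) : ZMod r) ∈ S)) :
    (h : ZMod r) ∈ S ∨ ((h + 1 : ℕ) : ZMod r) ∈ S := by
  obtain ⟨s, rfl⟩ := ht
  obtain ⟨q, hq⟩ := hr_even
  have hrq : (r : ℤ) = 2 * q := by rw [hq]; push_cast; ring
  have e1 : (2 * s + 1 - 1) / 2 = s := by omega
  have e2 : (2 * s + 1 + r + 1) / 2 = s + q + 1 := by omega
  have e3 : (2 * s + 1 + 1) / 2 = s + 1 := by omega
  have e4 : (2 * s + 1 + r - 1) / 2 = s + q := by omega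
  rw [e1, e2, e3, e4] at hS
  obtain ⟨k, hk⟩ := hmt.symm.dvd
  have hcast : ∀ a b : ℤ, (r : ℤ) ∣ b - a → (a : ZMod r) = b := fun a b hab =>
    (ZMod.intCast_eq_intCast_iff_dvd_sub a b r).2 hab
  have hhalf : (h : ℤ) - s = q * k := by
    rw [hrq] at hk
    push_cast at hk
    linarith
  -- With t = 2s + 1 and r = 2q, h = s + qk. Even k gives h ≡ s and odd k gives h ≡ s + q mod r:
  -- these are the cases m ≡ t and m ≡ t + r mod 2r.
  rcases Int.even_or_odd' k with ⟨l, rfl | rfl⟩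
  · have d1 : (s : ZMod r) = ((h : ℤ) : ZMod r) := hcast _ _ ⟨l, by rw [hrq, hhalf]; ring⟩
    have d2 : ((s + 1 : ℤ) : ZMod r) = (((h + 1 : ℕ) : ℤ) : ZMod r) :=
      hcast _ _ ⟨l, by rw [hrq]; push_cast; linarith⟩
    rw [Int.cast_natCast] at d1 d2
    rw [← d1, ← d2]
    exact hS.imp And.left And.left
  · have d1 : ((s + q : ℤ) : ZMod r) = ((h : ℤ) : ZMod r) :=
      hcast _ _ ⟨l, by rw [hrq]; linarith⟩
    have d2 : ((s + q + 1 : ℤ) : ZMod r) = (((h + 1 : ℕ) : ℤ) : ZMod r) :=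
      hcast _ _ ⟨l, by rw [hrq]; push_cast; linarith⟩
    rw [Int.cast_natCast] at d1 d2
    rw [← d1, ← d2]
    exact (hS.imp And.right And.right).symm

/-- For `m = 3` the residue hypotheses exclude `m ≡ t + r [ZMOD 2 * r]`. -/
theorem not_three_modEq_add {r : ℕ} {t : ℤ} {S : Set (ZMod r)} (hr_even : Even r) (ht : Odd t)
    (hS_pair : ∀ i ∈ S, (t : ZMod r) - i ∈ Sᶜ)
    (hS : ((((t + r + 1) / 2 : ℤ) : ZMod r) ∈ S ∧ (1 : ZMod r) ∈ S) ∨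
      ((((t + r - 1) / 2 : ℤ) : ZMod r) ∈ S ∧ ((t - 1 : ℤ) : ZMod r) ∈ S)) :
    ¬ ((3 : ℕ) : ℤ) ≡ t + r [ZMOD 2 * r] := by
  intro h
  obtain ⟨s, rfl⟩ := ht
  obtain ⟨q, hq⟩ := hr_even
  have hrq : (r : ℤ) = 2 * q := by rw [hq]; push_cast; ring
  have e2 : (2 * s + 1 + r + 1) / 2 = s + q + 1 := by omega
  have e4 : (2 * s + 1 + r - 1) / 2 = s + q := by omega
  rw [e2, e4] at hS
  obtain ⟨k, hk⟩ := h.dvd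
  have hcast : ∀ a b : ℤ, (r : ℤ) ∣ b - a → (a : ZMod r) = b := fun a b hab =>
    (ZMod.intCast_eq_intCast_iff_dvd_sub a b r).2 hab
  have hsq : s + q = 1 + r * k := by
    rw [hrq] at hk ⊢
    push_cast at hk
    linarith
  -- Modulo r, s + q ≡ 1 and t - 1 = 2s ≡ 2 ≡ s + q + 1. Either alternative therefore puts both 1
  -- and t - 1 in S, although i ↦ t - i sends S into its complement.
  rcases hS with ⟨h1, h2⟩ | ⟨h1, h2⟩
  · refine hS_pair 1 h2 ?_
    have : ((2 * s + 1 - 1 : ℤ) : ZMod r) = ((s + q + 1 : ℤ) : ZMod r) :=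
      hcast _ _ ⟨1 - k, by linarith⟩
    rw [← this] at h1
    simpa using h1
  · refine hS_pair _ h1 ?_
    have : ((2 * s + 1 - 1 : ℤ) : ZMod r) = ((2 * s + 1 - (s + q) : ℤ) : ZMod r) :=
      hcast _ _ ⟨-k, by linarith⟩
    rw [this] at h2
    simpa using h2

/-! ### The main theorem -/

theorem theorem9 {F : Type*} [Field F] [Fintype F] [Algebra (ZMod 2) F]
    (r m : ℕ) (t : ℤ) (S : Set (ZMod r)) (α : Fˣ)
    (hr : 0 < r) (hr_even : Even r) (hm : 3 ≤ m) (hm_odd : Odd m)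
    (hF : Fintype.card F = 2 ^ m) (hα : Subgroup.zpowers α = ⊤)
    (ht_odd : Odd t) (ht : t ≠ 1) (hmt : (m : ℤ) ≡ t [ZMOD r])
    (hS_card : S.ncard = r / 2)
    (hS_pair : ∀ i ∈ S, (t : ZMod r) - i ∈ Sᶜ)
    (hS : ((((t - 1) / 2 : ℤ) : ZMod r) ∈ S ∧ (((t + r + 1) / 2 : ℤ) : ZMod r) ∈ S ∧
            (1 : ZMod r) ∈ S) ∨
          ((((t + 1) / 2 : ℤ) : ZMod r) ∈ S ∧ (((t + r - 1) / 2 : ℤ) : ZMod r) ∈ S ∧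
            ((t - 1 : ℤ) : ZMod r) ∈ S)) :
    ∃ (g g' : Polynomial (ZMod 2)) (C C' : BinaryCode (2 ^ m - 1)),
      g.map (algebraMap (ZMod 2) F) = weightPoly (α : F) r m S ∧
      g'.map (algebraMap (ZMod 2) F) = weightPoly (α : F) r m Sᶜ ∧
      C = cyclicCode (2 ^ m - 1) g ∧ C' = cyclicCode (2 ^ m - 1) g' ∧
      (IsOddLikeDuadicPair (α : F) C C' ∧
        ∃ d : ℕ, HasParameters C (2 ^ m - 1) (2 ^ (m - 1)) d ∧
          HasParameters C' (2 ^ m - 1) (2 ^ (m - 1)) d ∧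
          ((m : ℤ) ≡ t [ZMOD 2 * r] → 2 ^ ((m - 1) / 2) + 1 ≤ d) ∧
          ((m : ℤ) ≡ t + r [ZMOD 2 * r] → 2 ^ ((m - 1) / 2) + 3 ≤ d)) ∧
      (IsEvenLikeDuadicPair (α : F) (dualCode C) (dualCode C') ∧
        ∃ d : ℕ, HasParameters (dualCode C) (2 ^ m - 1) (2 ^ (m - 1) - 1) d ∧
          HasParameters (dualCode C') (2 ^ m - 1) (2 ^ (m - 1) - 1) d ∧
          ((m : ℤ) ≡ t [ZMOD 2 * r] → 2 ^ ((m - 1) / 2) + 2 ≤ d) ∧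
          ((m : ℤ) ≡ t + r [ZMOD 2 * r] → 2 ^ ((m - 1) / 2) + 4 ≤ d)) ∧
      ((∃ d : ℕ, HasParameters (extendedCode C) (2 ^ m) (2 ^ (m - 1)) d ∧
          HasParameters (extendedCode C') (2 ^ m) (2 ^ (m - 1)) d ∧
          (5 ≤ m → 2 ^ ((m - 1) / 2) + 4 ≤ d)) ∧
        IsSelfDual (extendedCode C) ∧ IsDoublyEven (extendedCode C) ∧
        IsSelfDual (extendedCode C') ∧ IsDoublyEven (extendedCode C')) := by
  have hfour : ∃ k, 2 ^ m = 8 * k := (Nat.pow_dvd_pow 2 hm : 2 ^ 3 ∣ 2 ^ m)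
  have hpow : 2 ^ m = 2 * 2 ^ (m - 1) := by
    rw [← pow_succ', Nat.sub_add_cancel (by omega)]
  have hpos : 0 < 2 ^ m := by positivity
  have hpow4 : 4 ≤ 2 ^ (m - 1) := by
    obtain ⟨k, hk⟩ := hfour
    omega
  set n := 2 ^ m - 1 with hn
  have hnmod : n % 4 = 3 := by obtain ⟨k, hk⟩ := hfour; omega
  have hnodd : Odd n := Nat.odd_iff.2 (by omega)
  have : NeZero n := ⟨hnodd.pos.ne'⟩
  have hprim : IsPrimitiveRoot (α : F) n := by
    rw [IsPrimitiveRoot.coe_units_iff]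
    have h1 : orderOf α = n := by
      rw [orderOf_eq_card_of_zpowers_eq_top hα, Nat.card_units, Nat.card_eq_fintype_card, hF]
    exact h1 ▸ IsPrimitiveRoot.orderOf α
  have hmr : (m : ZMod r) = t := by
    have h := (ZMod.intCast_eq_intCast_iff _ _ r).2 hmt
    rwa [Int.cast_natCast] at h
  have hSiff := mem_iff_sub_notMem_of_ncard hr hr_even hS_card hS_pair
  have hSiff' : ∀ i, i ∈ Sᶜ ↔ (t : ZMod r) - i ∉ Sᶜ := fun i => by
    rw [Set.mem_compl_iff, Set.mem_compl_iff, hSiff i]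
  have hT : ∀ A : Set (ZMod r), ∀ j ∈ weightSet r m A, 1 ≤ j ∧ j < n :=
    fun A j hj => (mem_weightSet.1 hj).1
  have hTlt : ∀ A : Set (ZMod r), ∀ j ∈ weightSet r m A, j < n := fun A j hj => (hT A j hj).2
  have hdouble : ∀ A : Set (ZMod r), ∀ j ∈ weightSet r m A, 2 * j % n ∈ weightSet r m A :=
    fun A j hj => two_mul_mod_mem_weightSet (by omega) hj
  have hneg : ∀ j, 1 ≤ j → j < n → (j ∈ weightSet r m S ↔ n - j ∉ weightSet r m S) :=
    fun j h1 h2 => mem_weightSet_iff_sub hmr hSiff h1 h2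
  have hneg' : ∀ j, 1 ≤ j → j < n → (j ∈ weightSet r m Sᶜ ↔ n - j ∉ weightSet r m Sᶜ) :=
    fun j h1 h2 => mem_weightSet_iff_sub hmr hSiff' h1 h2
  have hcompl : ∀ j, 1 ≤ j → j < n → (j ∈ weightSet r m Sᶜ ↔ j ∉ weightSet r m S) :=
    fun j h1 h2 => mem_weightSet_compl h1 h2
  have hswap : ∀ j, 1 ≤ j → j < n → (j ∈ weightSet r m S ↔ n - j ∈ weightSet r m Sᶜ) :=
    fun j h1 h2 => by rw [hneg j h1 h2, hcompl _ (by omega) (by omega)]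
  obtain ⟨g, hg⟩ := exists_map_eq_rootPoly hprim.pow_eq_one hnodd (hTlt S) (hdouble S)
  obtain ⟨g', hg'⟩ := exists_map_eq_rootPoly hprim.pow_eq_one hnodd (hTlt Sᶜ) (hdouble Sᶜ)
  have hsplit := isSplitting_neg_one (hT S) (hT Sᶜ) hcompl hswap (hdouble S) (hdouble Sᶜ)
  have hcard := card_of_splitting (hT S) hneg
  have hcard' := card_of_splitting (hT Sᶜ) hneg'
  have hfin : Module.finrank (ZMod 2) (cyclicCode n g) = 2 ^ (m - 1) := by
    rw [finrank_cyclicCode hprim (hTlt S) hg]; omega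
  have hfin' : Module.finrank (ZMod 2) (cyclicCode n g') = 2 ^ (m - 1) := by
    rw [finrank_cyclicCode hprim (hTlt Sᶜ) hg']; omega
  have hdualfin : Module.finrank (ZMod 2) (dualCode (cyclicCode n g)) = 2 ^ (m - 1) - 1 := by
    rw [finrank_dualCode, hfin]; omega
  have hdualfin' : Module.finrank (ZMod 2) (dualCode (cyclicCode n g')) = 2 ^ (m - 1) - 1 := by
    rw [finrank_dualCode, hfin']; omega
  have hdual := dualCode_cyclicCode hprim hnodd (hT S) hneg hg
  have hdual' := dualCode_cyclicCode hprim hnodd (hT Sᶜ) hneg' hg'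
  have hDE := isDoublyEven_extendedCode_cyclicCode hprim hnmod (hT S) hneg hg
  have hDE' := isDoublyEven_extendedCode_cyclicCode hprim hnmod (hT Sᶜ) hneg' hg'
  have hmemdual : ∀ c, c ∈ dualCode (cyclicCode n g) ↔ c ∈ cyclicCode n g ∧ ∑ i, c i = 0 :=
    fun c => by rw [hdual, mem_cyclicCode_X_sub_one_mul_iff hprim hnodd.pos (hT S) hg]
  have hmemdual' : ∀ c, c ∈ dualCode (cyclicCode n g') ↔ c ∈ cyclicCode n g' ∧ ∑ i, c i = 0 :=
    fun c => by rw [hdual', mem_cyclicCode_X_sub_one_mul_iff hprim hnodd.pos (hT Sᶜ) hg']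
  have hrev : ∀ c ∈ cyclicCode n g, (fun i => c (-i)) ∈ cyclicCode n g' := fun c hc =>
    reverse_mem_cyclicCode hprim (hTlt S) (hTlt Sᶜ) (fun j hj => by
      have := hT _ j hj
      rwa [hswap _ (by omega) (by omega), show n - (n - j) = j by omega]) hg hg' hc
  have hrev' : ∀ c ∈ cyclicCode n g', (fun i => c (-i)) ∈ cyclicCode n g := fun c hc =>
    reverse_mem_cyclicCode hprim (hTlt Sᶜ) (hTlt S) (fun j hj => by
      have := hT _ j hj
      rwa [← hswap _ (by omega) (by omega)]) hg' hg hc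
  have hsumneg : ∀ c : Fin n → ZMod 2, ∑ i, c (-i) = ∑ i, c i := fun c =>
    Equiv.sum_comp (Equiv.neg (Fin n)) c
  have hD := minDistance_eq_of_reverse hrev hrev'
  have hDdual : minDistance (dualCode (cyclicCode n g)) = minDistance (dualCode (cyclicCode n g')) :=
    minDistance_eq_of_reverse
      (fun c hc => (hmemdual' _).2
        ⟨hrev c ((hmemdual c).1 hc).1, (hsumneg c).trans ((hmemdual c).1 hc).2⟩)
      (fun c hc => (hmemdual _).2
        ⟨hrev' c ((hmemdual' c).1 hc).1, (hsumneg c).trans ((hmemdual' c).1 hc).2⟩)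
  have hDext := minDistance_eq_of_hammingNorm (exists_reverse_mem_extendedCode hrev)
    (exists_reverse_mem_extendedCode hrev')
  obtain ⟨h, hh⟩ := hm_odd
  have hhalf : (m - 1) / 2 = h := by omega
  have hh0 : 0 < h := by omega
  -- It suffices to bound the code of S; reversal transfers the distance to the code of S'.
  have hbound : ∀ c ∈ cyclicCode n g, c ≠ 0 → 2 ^ h < hammingNorm c := by
    intro c hc hc0
    have hmem : ∃ k, (k = h ∨ k = h + 1) ∧ (k : ZMod r) ∈ S := by
      rw [hh] at hmt
      rcases exists_half_mem hr_even ht_odd hmt (hS.imp (fun H => ⟨H.1, H.2.1⟩)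
        fun H => ⟨H.1, H.2.1⟩) with H | H
      · exact ⟨h, Or.inl rfl, H⟩
      · exact ⟨h + 1, Or.inr rfl, H⟩
    obtain ⟨k, hk, hkS⟩ := hmem
    have hcop : Nat.Coprime (2 ^ k - 1) n := by
      rw [hn, hh]
      exact coprime_two_pow_sub_one hk
    refine lt_hammingNorm_of_wordEval_eq_zero (hprim.pow_of_coprime _ hcop) hc0 fun a ha hah => ?_
    rw [← pow_mul, mul_comm]
    refine (mem_cyclicCode_iff hprim (hTlt S) hg c).1 hc _ ?_
    rw [hh]
    exact mul_mem_weightSet hh0 (by omega) hk hkS ha hah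
  have heven : 2 ∣ 2 ^ h := dvd_pow_self 2 hh0.ne'
  have hfourdvd : 5 ≤ m → 4 ∣ 2 ^ h := fun h5 => Nat.pow_dvd_pow 2 (show 2 ≤ h by omega)
  have hfive : (m : ℤ) ≡ t + r [ZMOD 2 * r] → 5 ≤ m := by
    intro hmod
    by_contra hlt
    obtain rfl : m = 3 := by omega
    exact not_three_modEq_add hr_even ht_odd hS_pair
      (hS.imp (fun H => H.2) fun H => H.2) hmod
  have hdualeven : ∀ c ∈ dualCode (cyclicCode n g), 2 ∣ hammingNorm c := fun c hc =>
    ((even_hammingNorm_iff c).2 ((hmemdual c).1 hc).2).two_dvd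
  rw [hhalf]
  -- `weightPoly` unfolds to `rootPoly` of the weight set, so `hg` and `hg'` fit as they stand.
  refine ⟨g, g', _, _, hg, hg', rfl, rfl, ⟨?_, _, ⟨rfl, hfin, rfl⟩, ⟨rfl, hfin', hD.symm⟩, ?_, ?_⟩,
    ⟨?_, _, ⟨rfl, hdualfin, rfl⟩, ⟨rfl, hdualfin', hDdual.symm⟩, ?_, ?_⟩,
    ⟨_, ⟨by omega, ?_, rfl⟩, ⟨by omega, ?_, hDext.symm⟩, ?_⟩, ?_, hDE, ?_, hDE'⟩
  · exact ⟨_, _, _, hsplit, hasDefiningSet_cyclicCode hprim (hTlt S) hg,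
      hasDefiningSet_cyclicCode hprim (hTlt Sᶜ) hg'⟩
  · exact fun _ => le_minDistance (by omega) hbound
  · exact fun hmod => le_minDistance (by omega)
      (add_three_le_hammingNorm hDE hbound (hfourdvd (hfive hmod)))
  · have hset : ∀ {A : Set (ZMod r)} {f : (ZMod 2)[X]},
        f.map (algebraMap (ZMod 2) F) = rootPoly (α : F) (weightSet r m A) →
        HasDefiningSet (α : F) (cyclicCode n ((X - 1) * f))
          ({0} ∪ {i : ZMod n | i.val ∈ weightSet r m A}) := by
      intro A f hf
      rw [← setOf_val_mem_insert_zero]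
      refine hasDefiningSet_cyclicCode hprim ?_
        (map_X_sub_one_mul hf fun h0 => by simpa using (hT A 0 h0).1)
      intro j hj
      rcases Finset.mem_insert.1 hj with rfl | hj
      · exact hnodd.pos
      · exact hTlt A j hj
    rw [hdual, hdual']
    exact ⟨_, _, _, hsplit, hset hg, hset hg'⟩
  -- Dual weights are even, and so is 2^h: exceeding 2^h means reaching 2^h + 2.
  · refine fun _ => le_minDistance (by omega) fun c hc hc0 => ?_
    have h1 := hbound c ((hmemdual c).1 hc).1 hc0
    have h2 := hdualeven c hc
    omega
  · refine fun hmod => le_minDistance (by omega) fun c hc hc0 => ?_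
    have h1 := add_three_le_hammingNorm hDE hbound (hfourdvd (hfive hmod)) c
      ((hmemdual c).1 hc).1 hc0
    have h2 := hdualeven c hc
    omega
  · rw [finrank_extendedCode, hfin]
  · rw [finrank_extendedCode, hfin']
  · refine fun h5 => le_minDistance (by rw [finrank_extendedCode]; omega) ?_
    exact add_four_le_hammingNorm_of_mem_extendedCode hDE hbound (hfourdvd h5)
  · exact isSelfDual_extendedCode_cyclicCode hprim hnodd (hT S) hneg hg
  · exact isSelfDual_extendedCode_cyclicCode hprim hnodd (hT Sᶜ) hneg' hg'
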